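/- Let $(Q,\mathfrak m)\to(Q',\mathfrak m')$ be a finite flat extension of regular local rings with $\mathfrak m Q'=\mathfrak m'$. Let $I\subseteq Q$ and $J\subseteq Q'$ be ideals with $IQ'\subseteq J$, where $J$ is generated by a $Q'$-regular sequence (so $J\neq Q'$), and let $\varphi\colon R=Q/I\to S=Q'/J$ be the induced map. Put $V_R=I/\mathfrak m I$; for $f\in I$ let $[f]$ be its class in $V_R$, and for an $R$-module $M\ne 0$ let $$V_R(M)=\{\,v\in V_R \mid v=0,\ \text{or } v=[f] \text{ for some } f\in I \text{ with } \operatorname{pd}_{Q/f}M=\infty\,\}.$$ Then $$V_R(S)=\ker\bigl(I/\mathfrak m I\longrightarrow J/\mathfrak m'J\bigr),$$ where the map is induced by $Q\to Q'$. Moreover, for every nonzero $f\in I$, one has $\operatorname{pd}_{Q/f}(Q'/J)=\infty$ if and only if the image of $f$ in $Q'$ lies in $\mathfrak m'J$. -/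

import Mathlib

open CategoryTheory

universe u

noncomputable section

/-- For an ideal `I` of a local ring `(Q, 𝔪, k)`, the `k`-vector space `V_R = I / 𝔪 I` attached
to `R = Q / I`. (It is written as a `Q`-module; it is killed by `𝔪`, so its `Q`-submodules are
exactly its `k`-subspaces.) -/
abbrev VSpace {Q : Type u} [CommRing Q] [IsLocalRing Q] (I : Ideal Q) : Type u :=
  I ⧸ (IsLocalRing.maximalIdeal Q • ⊤ : Submodule Q I)

/-- The class `[f] ∈ I / 𝔪 I` of an element `f ∈ I`. -/
def VSpace.cls {Q : Type u} [CommRing Q] [IsLocalRing Q] {I : Ideal Q} (f : I) : VSpace I :=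
  Submodule.Quotient.mk f

/-- For `f ∈ I`, the projective dimension `pd_{Q/f} M` of a `Q/I`-module `M`, regarded as a
module over `Q/f` by restriction of scalars along `Q/f → Q/I`. -/
def pdHypersurface {Q : Type u} [CommRing Q] (I : Ideal Q) (f : I)
    (M : ModuleCat.{u} (Q ⧸ I)) : WithBot ℕ∞ :=
  projectiveDimension ((ModuleCat.restrictScalars (Ideal.Quotient.factor
    ((Ideal.span_singleton_le_iff_mem I).2 f.2 : Ideal.span {(f : Q)} ≤ I))).obj M)

/-- The cohomological support `V_R(M) ⊆ V_R` of an `R`-module `M`, where `R = Q / I`: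
the classes `[f]` with `pd_{Q/f} M = ∞` or `[f] = 0`. The support of the zero module is empty.
When `Q` (hence `R`) is complete and `M` is finitely generated, `M` is its own completion, so that
no completion appears. -/
def cohomologicalSupport {Q : Type u} [CommRing Q] [IsLocalRing Q] (I : Ideal Q)
    (M : ModuleCat.{u} (Q ⧸ I)) : Set (VSpace I) :=
  {v | Nontrivial M ∧ ((∃ f : I, VSpace.cls f = v ∧ pdHypersurface I f M = ⊤) ∨ v = 0)}

section Map

variable {Q Q' : Type u} [CommRing Q] [CommRing Q'] [Algebra Q Q']
  {I : Ideal Q} {J : Ideal Q'}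

/-- The ring `S = Q' / J` as a module over `R = Q / I`, along the map `φ : R → S` induced by
`Q → Q'` when `I Q' ⊆ J`. -/
def targetModule (hIJ : I ≤ J.comap (algebraMap Q Q')) : ModuleCat.{u} (Q ⧸ I) :=
  (ModuleCat.restrictScalars (Ideal.quotientMap J (algebraMap Q Q') hIJ)).obj
    (ModuleCat.of (Q' ⧸ J) (Q' ⧸ J))

/-- The map `I → J` obtained by restricting `Q → Q'`. -/
def idealMap (hIJ : I ≤ J.comap (algebraMap Q Q')) : I →ₛₗ[algebraMap Q Q'] J where
  toFun f := ⟨algebraMap Q Q' f, hIJ f.2⟩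
  map_add' f g := Subtype.ext (map_add (algebraMap Q Q') (f : Q) g)
  map_smul' a f := Subtype.ext (map_mul (algebraMap Q Q') a f)

variable [IsLocalRing Q] [IsLocalRing Q']

theorem idealMap_smul_le (hIJ : I ≤ J.comap (algebraMap Q Q'))
    (hm : (IsLocalRing.maximalIdeal Q).map (algebraMap Q Q') = IsLocalRing.maximalIdeal Q') :
    (IsLocalRing.maximalIdeal Q • ⊤ : Submodule Q I) ≤
      (IsLocalRing.maximalIdeal Q' • ⊤ : Submodule Q' J).comap (idealMap hIJ) := by
  refine Submodule.smul_le.2 fun a ha f _ => ?_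
  rw [Submodule.mem_comap, LinearMap.map_smulₛₗ]
  exact Submodule.smul_mem_smul (hm ▸ Ideal.mem_map_of_mem _ ha) trivial

/-- The map `V_φ : I / 𝔪 I → J / 𝔪' J` induced by `Q → Q'`. -/
def VMap (hIJ : I ≤ J.comap (algebraMap Q Q'))
    (hm : (IsLocalRing.maximalIdeal Q).map (algebraMap Q Q') = IsLocalRing.maximalIdeal Q') :
    VSpace I →ₛₗ[algebraMap Q Q'] VSpace J :=
  Submodule.mapQ _ _ (idealMap hIJ) (idealMap_smul_le hIJ hm)

end Map

end

/-
Both statements come down to deciding when `pd_{Q/f} (Q'/J)` is infinite. Let `R = Q'`. A finite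
module over `R/f` that is flat over `Q/f` is free over `R/f`, because `𝔪 R = 𝔪'`; comparing
syzygies, the projective dimension over `Q/f` agrees with that over `R/f`.

Write `J = (g)` with `g` a regular sequence. If `f ∈ J` is not in `𝔪' J`, then `f` can be exchanged
for one member of `g`, so `R/J` is the quotient of `R/f` by a regular sequence and has finite
projective dimension. If `f = ∑ aᵢ bᵢ` with `aᵢ ∈ 𝔪'` and `bᵢ ∈ J`, there is a square matrix `D`
with `D² = f`, some row of which lies in `𝔪'` while the column with the same index lies in `J`. The
2-periodic complex defined by `D` is exact over `R/f`, because `f` is a nonzerodivisor, and hence on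
every module of finite projective dimension. It is not exact on `R/J`, where the basis vector of
the distinguished index is a cycle but not a boundary.

The nonzerodivisor condition uses that a regular local ring is a domain. This is proved by induction
on the dimension: prime avoidance gives `x ∈ 𝔪 \ 𝔪²` outside the minimal primes; `(x)` is prime, and
Nakayama's lemma kills a minimal prime `p ⊆ (x)`, since `p = x p`.
-/

open IsLocalRing RingTheory.Sequence

section Exchange

variable {R : Type*} [CommRing R]

theorem ofList_eq_of_perm {g g' : List R} (h : g.Perm g') : Ideal.ofList g = Ideal.ofList g' :=
  congrArg Ideal.span (Set.ext fun _ => h.mem_iff)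

theorem ofList_cons_eq_of_sub_mem {f b : R} {u : Rˣ} {g : List R}
    (h : f - u * b ∈ Ideal.ofList g) : Ideal.ofList (f :: g) = Ideal.ofList (b :: g) := by
  have key {x y v : R} (hxy : x - v * y ∈ Ideal.ofList g) :
      Ideal.ofList (x :: g) ≤ Ideal.ofList (y :: g) := by
    simp only [Ideal.ofList_cons, sup_le_iff, le_sup_right, and_true,
      Ideal.span_singleton_le_iff_mem]
    rw [← sub_add_cancel x (v * y)]
    exact add_mem (Ideal.mem_sup_right hxy)
      (Ideal.mem_sup_left (Ideal.mul_mem_left _ v (Ideal.mem_span_singleton_self y)))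
  refine le_antisymm (key h) (key (v := ↑u⁻¹) ?_)
  convert neg_mem (Ideal.mul_mem_left _ (↑u⁻¹ : R) h) using 1
  rw [mul_sub, Units.inv_mul_cancel_left, neg_sub]

theorem ofList_ne_top_of_isRegular {g : List R} (hg : IsRegular R g) : Ideal.ofList g ≠ ⊤ :=
  fun h => hg.top_ne_smul (by rw [h, Submodule.top_smul])

theorem isWeaklyRegular_concat_of_sub_mem {f b : R} {u : Rˣ} {g : List R}
    (hg : IsWeaklyRegular R (g ++ [b])) (h : f - u * b ∈ Ideal.ofList g) :
    IsWeaklyRegular R (g ++ [f]) := by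
  rw [isWeaklyRegular_append_iff, isWeaklyRegular_singleton_iff] at hg ⊢
  refine ⟨hg.1, fun x y hxy => hg.2 (u.isUnit.isSMulRegular _ ?_)⟩
  have hfb (z : R ⧸ (Ideal.ofList g • ⊤ : Submodule R R)) : f • z = (u : R) • b • z := by
    obtain ⟨z, rfl⟩ := Submodule.mkQ_surjective _ z
    rw [← sub_eq_zero, ← mul_smul, ← sub_smul, ← map_smul]
    exact (Submodule.Quotient.mk_eq_zero _).2 (Submodule.smul_mem_smul h trivial)
  simpa only [hfb] using hxy

variable [IsLocalRing R] {f : R} {g : List R}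

theorem exists_perm_cons_of_notMem_maximalIdeal_mul (hf : f ∈ Ideal.ofList g)
    (hf' : f ∉ maximalIdeal R * Ideal.ofList g) :
    ∃ (b : R) (u : Rˣ) (g' : List R), g.Perm (b :: g') ∧ f - u * b ∈ Ideal.ofList g' := by
  induction g generalizing f with
  | nil =>
    rw [Ideal.ofList_nil, Ideal.mem_bot] at hf
    exact absurd (hf ▸ zero_mem _) hf'
  | cons x g ih =>
    rw [Ideal.ofList_cons] at hf hf'
    obtain ⟨_, hax, z, hz, rfl⟩ := Submodule.mem_sup.1 hf
    obtain ⟨a, rfl⟩ := Ideal.mem_span_singleton'.1 hax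
    by_cases ha : IsUnit a
    · obtain ⟨u, rfl⟩ := ha
      exact ⟨x, u, g, .refl _, by rwa [add_sub_cancel_left]⟩
    · have hax' : a * x ∈ maximalIdeal R * (Ideal.span {x} ⊔ Ideal.ofList g) :=
        Ideal.mul_mem_mul ((mem_maximalIdeal a).2 ha)
          (Ideal.mem_sup_left (Ideal.mem_span_singleton_self x))
      obtain ⟨b, u, g', hp, h⟩ := ih hz fun h =>
        hf' (add_mem hax' (Ideal.mul_mono_right le_sup_right h))
      refine ⟨b, u, x :: g', (hp.cons x).trans (.swap b x g'), ?_⟩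
      rw [Ideal.ofList_cons, add_sub_assoc]
      exact add_mem (Ideal.mem_sup_left hax) (Ideal.mem_sup_right h)

theorem exists_perm_cons_ofList_eq_of_notMem_maximalIdeal_mul (hf : f ∈ Ideal.ofList g)
    (hf' : f ∉ maximalIdeal R * Ideal.ofList g) :
    ∃ (b : R) (u : Rˣ) (g' : List R), g.Perm (b :: g') ∧ f - u * b ∈ Ideal.ofList g' ∧
      Ideal.ofList (f :: g') = Ideal.ofList g := by
  obtain ⟨b, u, g', hp, h⟩ := exists_perm_cons_of_notMem_maximalIdeal_mul hf hf'
  exact ⟨b, u, g', hp, h, (ofList_cons_eq_of_sub_mem h).trans (ofList_eq_of_perm hp).symm⟩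

theorem exists_isWeaklyRegular_cons_of_notMem_maximalIdeal_mul [IsNoetherianRing R]
    (hg : IsRegular R g) (hf : f ∈ Ideal.ofList g) (hf' : f ∉ maximalIdeal R * Ideal.ofList g) :
    ∃ g' : List R, IsWeaklyRegular R (f :: g') ∧ Ideal.ofList (f :: g') = Ideal.ofList g := by
  obtain ⟨b, u, g', hp, h, heq⟩ := exists_perm_cons_ofList_eq_of_notMem_maximalIdeal_mul hf hf'
  have hb : IsWeaklyRegular R (g' ++ [b]) := (IsLocalRing.isRegular_of_perm hg
    (hp.trans (List.perm_append_singleton b g').symm)).toIsWeaklyRegular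
  have hperm : (g' ++ [f]).Perm (f :: g') := List.perm_append_singleton f g'
  have hmax : Ideal.ofList (f :: g') ≤ maximalIdeal R :=
    heq ▸ le_maximalIdeal (ofList_ne_top_of_isRegular hg)
  exact ⟨g', IsLocalRing.isWeaklyRegular_of_perm_of_subset_maximalIdeal
    (isWeaklyRegular_concat_of_sub_mem hb h) hperm fun r hr =>
      hmax (Ideal.subset_span (hperm.mem_iff.1 hr)), heq⟩

end Exchange

section RegularLocalRing

variable {R : Type*} [CommRing R]

theorem spanFinrank_ofList_le (g : List R) : (Ideal.ofList g).spanFinrank ≤ g.length := by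
  classical
  have h : {r | r ∈ g} = (g.toFinset : Set R) := by ext; simp
  refine (Submodule.spanFinrank_span_le_ncard_of_finite (h ▸ g.toFinset.finite_toSet)).trans ?_
  rw [h, Set.ncard_coe_finset]
  exact g.toFinset_card_le

theorem exists_ofList_eq_maximalIdeal [IsLocalRing R] [IsNoetherianRing R] :
    ∃ g : List R, Ideal.ofList g = maximalIdeal R ∧
      g.length = (maximalIdeal R).spanFinrank := by
  obtain ⟨s, hs, hsm⟩ := Submodule.FG.exists_span_finset_card_eq_spanFinrank
    (IsNoetherian.noetherian (maximalIdeal R))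
  refine ⟨s.toList, ?_, by rw [s.length_toList, hs]⟩
  rw [← hsm]
  exact congrArg Ideal.span (Set.ext fun _ => Finset.mem_toList)

theorem map_ofList_cons_of_eq_zero {A : Type*} [CommRing A] {φ : R →+* A} {x : R} (hx : φ x = 0)
    (g : List R) : (Ideal.ofList (x :: g)).map φ = Ideal.ofList (g.map φ) := by
  rw [Ideal.map_ofList, List.map_cons, Ideal.ofList_cons, hx, Ideal.span_singleton_zero, bot_sup_eq]

variable {x : R}

theorem isLocalRing_quotient_span_singleton [IsLocalRing R] (hx : x ∈ maximalIdeal R) :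
    IsLocalRing (R ⧸ Ideal.span {x}) := by
  have : Nontrivial (R ⧸ Ideal.span {x}) := Ideal.Quotient.nontrivial_iff.2 <|
    ne_top_of_le_ne_top (maximalIdeal.isMaximal R).ne_top
      ((Ideal.span_singleton_le_iff_mem _).2 hx)
  exact .of_surjective' _ Ideal.Quotient.mk_surjective

theorem isRegularLocalRing_quotient_span_singleton [IsRegularLocalRing R]
    (hx : x ∈ maximalIdeal R) (hx' : x ∉ maximalIdeal R ^ 2) :
    IsRegularLocalRing (R ⧸ Ideal.span {x}) ∧
      ringKrullDim (R ⧸ Ideal.span {x}) + 1 = ringKrullDim R := by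
  have := isLocalRing_quotient_span_singleton hx
  obtain ⟨g, hg, hlen⟩ := exists_ofList_eq_maximalIdeal (R := R)
  obtain ⟨b, u, g', hp, -, hg'⟩ := exists_perm_cons_ofList_eq_of_notMem_maximalIdeal_mul (f := x)
    (g := g) (hg ▸ hx) (by rwa [hg, ← pow_two])
  have hmax : maximalIdeal (R ⧸ Ideal.span {x}) =
      Ideal.ofList (g'.map (Ideal.Quotient.mk (Ideal.span {x}))) := by
    rw [← map_ofList_cons_of_eq_zero (Ideal.Quotient.eq_zero_iff_mem.2
      (Ideal.mem_span_singleton_self x)), hg', hg,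
      map_maximalIdeal_of_surjective _ Ideal.Quotient.mk_surjective]
  have hrank : (maximalIdeal (R ⧸ Ideal.span {x})).spanFinrank ≤ g'.length :=
    hmax ▸ (spanFinrank_ofList_le _).trans_eq (List.length_map _)
  have hdimR : ringKrullDim R = g'.length + 1 := by
    rw [← IsRegularLocalRing.spanFinrank_maximalIdeal, ← hlen, hp.length_eq, List.length_cons]
    push_cast
    rfl
  have hdim : (g'.length : WithBot ℕ∞) ≤ ringKrullDim (R ⧸ Ideal.span {x}) := by
    have h := Ideal.height_le_ringKrullDim_quotient_add_one hx
    rw [IsLocalRing.maximalIdeal_height_eq_ringKrullDim, hdimR] at h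
    exact ENat.WithBot.add_le_add_one_right_iff.1 h
  have hrank' : ((maximalIdeal (R ⧸ Ideal.span {x})).spanFinrank : WithBot ℕ∞) ≤ g'.length :=
    by exact_mod_cast hrank
  refine ⟨.of_spanFinrank_maximalIdeal_le _ (hrank'.trans hdim), ?_⟩
  rw [hdimR, le_antisymm
    ((ringKrullDim_le_spanFinrank_maximalIdeal _).trans hrank') hdim]

theorem exists_mem_maximalIdeal_notMem_sq_notMem_minimalPrimes [IsLocalRing R]
    [IsNoetherianRing R] (h : 0 < ringKrullDim R) :
    ∃ x ∈ maximalIdeal R, x ∉ maximalIdeal R ^ 2 ∧ ∀ p ∈ minimalPrimes R, x ∉ p := by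
  classical
  have hfin := minimalPrimes.finite_of_isNoetherianRing R
  have hheight : maximalIdeal R ∉ minimalPrimes R := fun hmin => by
    rw [← IsLocalRing.maximalIdeal_height_eq_ringKrullDim,
      Ideal.height_eq_zero_iff.2 hmin] at h
    exact lt_irrefl _ h
  have hsq : ¬ maximalIdeal R ≤ maximalIdeal R ^ 2 :=
    (IsLocalRing.maximalIdeal_sq_lt_of_ringKrullDim_ne_zero h.ne').not_ge
  let s : Finset (Ideal R) := insert (maximalIdeal R ^ 2) hfin.toFinset
  have hunion : ¬ (maximalIdeal R : Set R) ⊆ ⋃ i ∈ (s : Set (Ideal R)), (id i : Ideal R) := by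
    rw [Ideal.subset_union_prime (maximalIdeal R ^ 2) (maximalIdeal R ^ 2)]
    · rintro ⟨p, hp, hle⟩
      obtain rfl | hp := Finset.mem_insert.1 hp
      · exact hsq hle
      · have hp := hfin.mem_toFinset.1 hp
        exact hheight (((le_maximalIdeal hp.1.1.ne_top).antisymm hle) ▸ hp)
    · intro p hp hne _
      exact (hfin.mem_toFinset.1 ((Finset.mem_insert.1 hp).resolve_left hne)).1.1
  obtain ⟨x, hx, hxs⟩ := Set.not_subset.1 hunion
  simp only [Set.mem_iUnion, not_exists] at hxs
  exact ⟨x, hx, hxs _ (Finset.mem_insert_self _ _), fun p hp => hxs p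
    (Finset.mem_insert_of_mem (hfin.mem_toFinset.2 hp))⟩

theorem isDomain_of_isPrime_span_singleton [IsLocalRing R] [IsNoetherianRing R]
    (hx : x ∈ maximalIdeal R) (hprime : (Ideal.span {x}).IsPrime)
    (hmin : ∀ p ∈ minimalPrimes R, x ∉ p) : IsDomain R := by
  obtain ⟨p, hp, hpx⟩ := Ideal.exists_minimalPrimes_le (bot_le (a := Ideal.span {x}))
  have hp' : p.IsPrime := hp.1.1
  have hle : p ≤ maximalIdeal R • p := fun y hy => by
    obtain ⟨z, rfl⟩ := Ideal.mem_span_singleton'.1 (hpx hy)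
    rw [mul_comm]
    exact Submodule.smul_mem_smul hx ((hp'.mem_or_mem hy).resolve_right (hmin p hp))
  rw [Submodule.eq_bot_of_le_smul_of_le_jacobson_bot (maximalIdeal R) _
    (IsNoetherian.noetherian _) hle (IsLocalRing.maximalIdeal_le_jacobson _)] at hp'
  exact IsDomain.of_bot_isPrime R

theorem isDomain_of_ringKrullDim_eq (n : ℕ) (R : Type*) [CommRing R] [IsRegularLocalRing R]
    (hn : ringKrullDim R = n) : IsDomain R := by
  induction n generalizing R with
  | zero =>
    rw [← IsRegularLocalRing.spanFinrank_maximalIdeal, Nat.cast_inj,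
      Submodule.spanFinrank_eq_zero_iff_eq_bot (IsNoetherian.noetherian _)] at hn
    exact (IsLocalRing.isField_iff_maximalIdeal_eq.2 hn).isDomain
  | succ n ih =>
    obtain ⟨x, hx, hx', hmin⟩ := exists_mem_maximalIdeal_notMem_sq_notMem_minimalPrimes
      (R := R) (by rw [hn]; exact_mod_cast n.succ_pos)
    obtain ⟨_, hdim⟩ := isRegularLocalRing_quotient_span_singleton hx hx'
    have : IsDomain (R ⧸ Ideal.span {x}) := ih _ <|
      ENat.WithBot.add_one_cancel.1 (hdim.trans (by simpa using hn))
    exact isDomain_of_isPrime_span_singleton hx ((Ideal.Quotient.isDomain_iff_prime _).1 this) hmin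

theorem isDomain_of_isRegularLocalRing (R : Type*) [CommRing R] [IsRegularLocalRing R] :
    IsDomain R :=
  isDomain_of_ringKrullDim_eq _ R (IsRegularLocalRing.spanFinrank_maximalIdeal (R := R)).symm

end RegularLocalRing

section MatrixExactness

open scoped Matrix.Module TensorProduct

theorem exact_smul_of_exact_of_surjective {Λ X Y Z : Type*} [Ring Λ] [AddCommGroup X]
    [AddCommGroup Y] [AddCommGroup Z] [Module Λ X] [Module Λ Y] [Module Λ Z] {i : X →ₗ[Λ] Y}
    {p : Y →ₗ[Λ] Z} (hi : Function.Injective i) (hip : Function.Exact i p)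
    (hp : Function.Surjective p) {d : Λ} (hX : Function.Exact (d • · : X → X) (d • ·))
    (hY : Function.Exact (d • · : Y → Y) (d • ·)) : Function.Exact (d • · : Z → Z) (d • ·) := by
  intro z
  constructor
  · intro hz
    obtain ⟨y, rfl⟩ := hp z
    obtain ⟨x, hx⟩ := (hip (d • y)).1 (by rw [map_smul]; exact hz)
    obtain ⟨x', rfl⟩ := (hX x).1 <| hi <| by
      rw [map_smul, hx, map_zero]
      exact (hY (d • y)).2 ⟨y, rfl⟩
    have hy : d • (y - i x') = 0 := by
      rw [smul_sub, ← hx, ← map_smul, sub_self]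
    obtain ⟨w, hw⟩ := (hY _).1 hy
    refine ⟨p w, ?_⟩
    simp only [← map_smul, hw, map_sub, (hip (i x')).2 ⟨x', rfl⟩, sub_zero]
  · rintro ⟨w, rfl⟩
    obtain ⟨y, rfl⟩ := hp w
    simp only [← map_smul, (hY (d • y)).2 ⟨y, rfl⟩, map_zero]

variable {ι : Type*} [Fintype ι] [DecidableEq ι] {A : Type*} [CommRing A]

/-- The 2-periodic sequence `⋯ → Mⁿ → Mⁿ → Mⁿ → ⋯`, all of whose maps are given by the square
matrix `D`, is exact. In particular `D * D` annihilates `Mⁿ`. -/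
def IsExactOn (D : Matrix ι ι A) (M : Type*) [AddCommGroup M] [Module A M] : Prop :=
  Function.Exact (D • · : (ι → M) → ι → M) (D • ·)

namespace IsExactOn

variable {D : Matrix ι ι A} {K F M : Type*} [AddCommGroup K] [Module A K] [AddCommGroup F]
  [Module A F] [AddCommGroup M] [Module A M]

theorem of_flat (h : IsExactOn D A) [Module.Flat A M] : IsExactOn D M := by
  let e : M ⊗[A] (ι → A) ≃ₗ[A] (ι → M) := TensorProduct.piScalarRight A A M ι
  have he (t : M ⊗[A] (ι → A)) : D • e t = e (D.mulVecLin.lTensor M t) := by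
    induction t with
    | zero => simp
    | add s t hs ht => rw [map_add, smul_add, hs, ht, map_add, map_add]
    | tmul m v =>
      ext j
      simp [e, Matrix.Module.smul_apply, Matrix.mulVec, dotProduct, mul_smul, Finset.sum_smul]
  have hsq : (DistribSMul.toAddMonoidHom (ι → M) D).comp e.toAddEquiv =
      (e.toAddEquiv : _ →+ _).comp (D.mulVecLin.lTensor M).toAddMonoidHom :=
    AddMonoidHom.ext he
  exact (Function.Exact.iff_of_ladder_addEquiv _ _ _ hsq hsq).2
    (Module.Flat.lTensor_exact M (f := D.mulVecLin) (g := D.mulVecLin) h)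

theorem of_exact_of_surjective (hK : IsExactOn D K) (hF : IsExactOn D F) {i : K →ₗ[A] F}
    {p : F →ₗ[A] M} (hi : Function.Injective i) (hip : Function.Exact i p)
    (hp : Function.Surjective p) : IsExactOn D M := by
  refine exact_smul_of_exact_of_surjective (i := i.mapMatrixModule ι) (p := p.mapMatrixModule ι)
    hi.comp_left (fun y => ?_) hp.comp_left hK hF
  constructor
  · intro hy
    choose x hx using fun j => (hip (y j)).1 (congrFun hy j)
    exact ⟨x, funext hx⟩
  · rintro ⟨x, rfl⟩
    exact funext fun j => hip.apply_apply_eq_zero (x j)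

theorem of_hasProjectiveDimensionLE {A : Type u} [CommRing A] {D : Matrix ι ι A}
    (h : IsExactOn D A) (n : ℕ) (M : Type u) [AddCommGroup M] [Module A M]
    (hM : HasProjectiveDimensionLE (ModuleCat.of A M) n) : IsExactOn D M := by
  induction n generalizing M with
  | zero =>
    rw [← projective_iff_hasProjectiveDimensionLE_zero, ← IsProjective.iff_projective] at hM
    exact h.of_flat
  | succ n ih =>
    let p : (M →₀ A) →ₗ[A] M := Finsupp.linearCombination A id
    have hp : Function.Surjective p := Finsupp.linearCombination_id_surjective A M
    have hF : Projective (ModuleCat.of A (M →₀ A)) :=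
      (IsProjective.iff_projective (M →₀ A)).1 inferInstance
    have hK := ((p.shortExact_shortComplexKer hp).hasProjectiveDimensionLT_X₃_iff n hF).1 hM
    exact (ih (LinearMap.ker p) hK).of_exact_of_surjective h.of_flat
      (Submodule.subtype_injective _) p.exact_subtype_ker_map hp

end IsExactOn

variable {R : Type*} [CommRing R]

theorem isExactOn_map_algebraMap_of_mul_self_eq_scalar [Algebra R A] {D : Matrix ι ι R} {f : R}
    (hD : D * D = Matrix.scalar ι f) (hf : f ∈ nonZeroDivisors R)
    (hA : Function.Surjective (algebraMap R A))
    (hker : RingHom.ker (algebraMap R A) = Ideal.span {f}) :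
    IsExactOn (D.map (algebraMap R A)) A := by
  have hmap (v : ι → R) :
      D.map (algebraMap R A) • (algebraMap R A ∘ v) = algebraMap R A ∘ (D • v) :=
    funext fun i => ((algebraMap R A).map_mulVec D v i).symm
  have hDD (v : ι → R) : D • D • v = f • v := by
    rw [← mul_smul, hD, Matrix.Module.scalar_smul]
  have hzero (v : ι → R) : algebraMap R A ∘ v = 0 ↔ ∃ w : ι → R, f • w = v := by
    simp only [funext_iff, Function.comp_apply, Pi.zero_apply, ← RingHom.mem_ker, hker,
      Ideal.mem_span_singleton, Pi.smul_apply, smul_eq_mul, dvd_def, eq_comm (a := v _)]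
    exact Classical.skolem
  have hinj (v w : ι → R) (h : f • v = f • w) : v = w := funext fun i =>
    (mul_cancel_left_mem_nonZeroDivisors hf).1 (congrFun h i)
  intro x
  obtain ⟨v, rfl⟩ := hA.comp_left x
  constructor
  · intro hv
    obtain ⟨w, hw⟩ := (hzero _).1 ((hmap v).symm.trans hv)
    refine ⟨algebraMap R A ∘ w, (hmap w).trans ?_⟩
    rw [hinj (D • w) v]
    rw [← hDD v, ← hw, smul_comm]
  · rintro ⟨y, hy⟩
    obtain ⟨w, rfl⟩ := hA.comp_left y
    rw [← hy]
    simp only [hmap, hDD]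
    exact (hzero _).2 ⟨w, rfl⟩

theorem not_isExactOn_of_row_mem_maximalIdeal [IsLocalRing A] {D : Matrix ι ι A} {M : Type*}
    [AddCommGroup M] [Module A M] [Module.Finite A M] [Nontrivial M] {o : ι}
    (hrow : ∀ j, D o j ∈ maximalIdeal A) (hcol : ∀ j, D j o ∈ Module.annihilator A M) :
    ¬ IsExactOn D M := by
  intro h
  obtain ⟨x, -, hx⟩ := SetLike.exists_of_lt <| lt_top_iff_ne_top.2
    (Submodule.top_ne_ideal_smul_of_le_jacobson_annihilator (M := M)
      (IsLocalRing.maximalIdeal_le_jacobson (Module.annihilator A M))).symm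
  have hker : D • (Pi.single o x : ι → M) = 0 := by
    ext i
    rw [Matrix.Module.smul_apply, Finset.sum_eq_single_of_mem o (Finset.mem_univ o)
      fun j _ hj => by rw [Pi.single_eq_of_ne hj, smul_zero], Pi.single_eq_same]
    exact Module.mem_annihilator.1 (hcol i) x
  obtain ⟨y, hy⟩ := (h _).1 hker
  refine hx ?_
  rw [← Pi.single_eq_same (M := fun _ => M) o x, ← hy]
  exact Submodule.sum_mem _ fun j _ => Submodule.smul_mem_smul (hrow j) trivial

-- Iterating this over the summands of `f = ∑ aᵢ bᵢ`, starting from `0 * 0 = 0`, gives a matrix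
-- factorization of `f` whose entries are linear in the `aᵢ` and `bᵢ`.
theorem fromBlocks_mul_self_eq_scalar {D : Matrix ι ι R} {f : R} (hD : D * D = Matrix.scalar ι f)
    (a b : R) :
    Matrix.fromBlocks D (Matrix.scalar ι b) (Matrix.scalar ι a) (-D) *
      Matrix.fromBlocks D (Matrix.scalar ι b) (Matrix.scalar ι a) (-D) =
        Matrix.scalar (ι ⊕ ι) (f + a * b) := by
  have hc (r : R) : Matrix.scalar ι r * D = D * Matrix.scalar ι r :=
    (Matrix.scalar_commute r (Commute.all r) D).eq
  rw [Matrix.fromBlocks_multiply, mul_neg, hc, add_neg_cancel, neg_mul, hc, add_neg_cancel,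
    neg_mul_neg, hD, ← map_mul, ← map_mul, ← map_add, ← map_add, mul_comm b a,
    add_comm (a * b) f]
  ext (i | i) (j | j) <;> simp [Matrix.diagonal_apply]

/-- A matrix factorization `D * D = f` together with an index `o` such that the row of `o` has
entries in `I` and the column of `o` has entries in `K`. With `I` the maximal ideal and `K` the
annihilator of a module, these are the conditions under which `D` fails to be exact on the
module. -/
def HasMatrixFactorization (I K : Ideal R) (f : R) : Prop :=
  ∃ (ι : Type) (_ : Fintype ι) (_ : DecidableEq ι) (D : Matrix ι ι R) (o : ι),
    D * D = Matrix.scalar ι f ∧ (∀ j, D o j ∈ I) ∧ ∀ j, D j o ∈ K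

theorem HasMatrixFactorization.add_mul {I K : Ideal R} {f a b : R}
    (hf : HasMatrixFactorization I K f) (ha : a ∈ I) (hb : b ∈ K) :
    HasMatrixFactorization I K (f + a * b) := by
  obtain ⟨ι, _, _, D, o, hD, hI, hK⟩ := hf
  refine ⟨ι ⊕ ι, inferInstance, inferInstance, _, .inr o, fromBlocks_mul_self_eq_scalar hD a b,
    ?_, ?_⟩
  · rintro (j | j)
    · by_cases h : o = j <;> simp [h, ha]
    · simpa using hI j
  · rintro (j | j)
    · by_cases h : j = o <;> simp [h, hb]
    · simpa using hK j

theorem hasMatrixFactorization_of_mem_mul {I K : Ideal R} {f : R} (hf : f ∈ I * K) :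
    HasMatrixFactorization I K f := by
  suffices H : ∀ h, HasMatrixFactorization I K h → HasMatrixFactorization I K (h + f) by
    rw [← zero_add f]
    exact H 0 ⟨Unit, inferInstance, inferInstance, 0, (), by simp, by simp, by simp⟩
  refine Submodule.mul_induction_on hf (fun a ha b hb h hh => hh.add_mul ha hb)
    fun x y hx hy h hh => ?_
  rw [← add_assoc]
  exact hy _ (hx _ hh)

end MatrixExactness

section Hypersurface

open scoped Pointwise

variable {R : Type*} {A : Type u} [CommRing R] [CommRing A] [Algebra R A] {f : R}

theorem projectiveDimension_eq_top_of_mem_maximalIdeal_mul_annihilator [IsLocalRing R]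
    (hA : Function.Surjective (algebraMap R A))
    (hker : RingHom.ker (algebraMap R A) = Ideal.span {f}) (hf : f ∈ nonZeroDivisors R)
    (M : Type u) [AddCommGroup M] [Module R M] [Module A M] [IsScalarTower R A M]
    [Module.Finite A M] [Nontrivial M] (hfM : f ∈ maximalIdeal R * Module.annihilator R M) :
    projectiveDimension (ModuleCat.of A M) = ⊤ := by
  have : Nontrivial A := Module.nontrivial A M
  have : IsLocalRing A := .of_surjective' _ hA
  have : IsLocalHom (algebraMap R A) := .of_surjective _ hA
  obtain ⟨ι, _, _, D, o, hD, hrow, hcol⟩ := hasMatrixFactorization_of_mem_mul hfM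
  by_contra hpd
  obtain ⟨n, hn⟩ := (projectiveDimension_ne_top_iff _).1 hpd
  refine not_isExactOn_of_row_mem_maximalIdeal (o := o) (fun j => ?_) (fun j => ?_)
    ((isExactOn_map_algebraMap_of_mul_self_eq_scalar hD hf hA hker).of_hasProjectiveDimensionLE
      n M hn)
  · exact (map_mem_nonunits_iff (algebraMap R A) _).2 (hrow j)
  · refine Module.mem_annihilator.2 fun m => ?_
    rw [Matrix.map_apply, algebraMap_smul]
    exact Module.mem_annihilator.1 (hcol j) m

theorem isWeaklyRegular_map_algebraMap_of_isWeaklyRegular_cons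
    {g : List R} (hA : Function.Surjective (algebraMap R A))
    (hker : RingHom.ker (algebraMap R A) = Ideal.span {f}) (h : IsWeaklyRegular R (f :: g)) :
    IsWeaklyRegular A (g.map (algebraMap R A)) := by
  have hspan : f • (⊤ : Submodule R R) = LinearMap.ker (Algebra.linearMap R A) := by
    rw [← Submodule.ideal_span_singleton_smul, smul_eq_mul, Ideal.mul_top, ← hker]
    rfl
  let e : QuotSMulTop f R ≃ₗ[R] A :=
    (Submodule.quotEquivOfEq _ _ hspan).trans
      ((Algebra.linearMap R A).quotKerEquivOfSurjective hA)
  exact (isWeaklyRegular_map_algebraMap_iff A A g).2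
    ((e.isWeaklyRegular_congr g).1 ((isWeaklyRegular_cons_iff _ _ _).1 h).2)

variable {S : Type u} [CommRing S] [Algebra R S] [Algebra A S] [IsScalarTower R A S] {g : List R}

theorem ker_algebraMap_eq_ofList_map (hA : Function.Surjective (algebraMap R A))
    (hf : algebraMap R A f = 0) (hker : RingHom.ker (algebraMap R S) = Ideal.ofList (f :: g)) :
    RingHom.ker (algebraMap A S) = Ideal.ofList (g.map (algebraMap R A)) := by
  rw [← map_ofList_cons_of_eq_zero hf, ← hker, IsScalarTower.algebraMap_eq R A S,
    ← RingHom.comap_ker, Ideal.map_comap_of_surjective _ hA]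

theorem projectiveDimension_eq_length_of_isWeaklyRegular [IsLocalRing A] [IsNoetherianRing A]
    [Nontrivial S] {g : List A} (hS : Function.Surjective (algebraMap A S))
    (hker : RingHom.ker (algebraMap A S) = Ideal.ofList g) (hg : IsWeaklyRegular A g) :
    projectiveDimension (ModuleCat.of A S) = g.length := by
  have htop : ⊤ ≠ Ideal.ofList g • (⊤ : Submodule A A) := by
    rw [smul_eq_mul, Ideal.mul_top, ← hker]
    exact (RingHom.ker_ne_top _).symm
  let e : (A ⧸ Ideal.ofList g) ≃ₗ[A] S := (Submodule.quotEquivOfEq _ _ hker.symm).trans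
    ((Algebra.linearMap A S).quotKerEquivOfSurjective hS)
  rw [← ModuleCat.projectiveDimension_quotient_eq_length g ⟨hg, htop⟩]
  exact projectiveDimension_eq_of_iso (e.symm.trans (Shrink.linearEquiv A _).symm).toModuleIso

theorem projectiveDimension_eq_top_iff_mem_maximalIdeal_mul_ofList [IsLocalRing R]
    [IsNoetherianRing R]
    (hA : Function.Surjective (algebraMap R A))
    (hkerA : RingHom.ker (algebraMap R A) = Ideal.span {f}) (hf : f ∈ nonZeroDivisors R)
    (hS : Function.Surjective (algebraMap R S))
    (hkerS : RingHom.ker (algebraMap R S) = Ideal.ofList g) (hg : IsRegular R g) :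
    projectiveDimension (ModuleCat.of A S) = ⊤ ↔ f ∈ maximalIdeal R * Ideal.ofList g := by
  have hAS : Function.Surjective (algebraMap A S) := .of_comp (g := algebraMap R A) <| by
    rwa [← RingHom.coe_comp, ← IsScalarTower.algebraMap_eq]
  have : Nontrivial S := nontrivial_of_ne (1 : S) 0 fun h =>
    ofList_ne_top_of_isRegular hg <| hkerS ▸ (Ideal.eq_top_iff_one _).2 ((map_one _).trans h)
  have : Nontrivial A := (algebraMap A S).domain_nontrivial
  have : IsLocalRing A := .of_surjective' _ hA
  have : IsNoetherianRing A := isNoetherianRing_of_surjective _ _ _ hA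
  have hfA : algebraMap R A f = 0 := by
    rw [← RingHom.mem_ker, hkerA]
    exact Ideal.mem_span_singleton_self f
  refine ⟨fun htop => ?_, fun hmem => ?_⟩
  · by_contra hmem
    have hfg : f ∈ Ideal.ofList g := by
      rw [← hkerS, RingHom.mem_ker, IsScalarTower.algebraMap_apply R A S, hfA, map_zero]
    obtain ⟨g', hreg, hgen⟩ :=
      exists_isWeaklyRegular_cons_of_notMem_maximalIdeal_mul hg hfg hmem
    rw [projectiveDimension_eq_length_of_isWeaklyRegular hAS
      (ker_algebraMap_eq_ofList_map hA hfA (hkerS.trans hgen.symm))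
      (isWeaklyRegular_map_algebraMap_of_isWeaklyRegular_cons hA hkerA hreg)] at htop
    exact ENat.natCast_ne_top _ (WithBot.coe_injective htop)
  · have : Module.Finite A S := .of_surjective (Algebra.linearMap A S) hAS
    have hann : Ideal.ofList g ≤ Module.annihilator R S := fun r hr => by
      rw [← hkerS, RingHom.mem_ker] at hr
      exact Module.mem_annihilator.2 fun s => by rw [Algebra.smul_def, hr, zero_mul]
    exact projectiveDimension_eq_top_of_mem_maximalIdeal_mul_annihilator hA hkerA hf S
      (Ideal.mul_mono_right hann hmem)

end Hypersurface

section ChangeOfRings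

open scoped TensorProduct

variable {A A' : Type*} [CommRing A] [CommRing A'] [Algebra A A']

theorem projective_of_projective_of_isScalarTower [Module.Projective A A'] (P : Type*)
    [AddCommGroup P] [Module A P] [Module A' P] [IsScalarTower A A' P] [Module.Projective A' P] :
    Module.Projective A P := by
  classical
  have : Module.Projective A (P →₀ A') := .of_equiv (finsuppLequivDFinsupp A).symm
  obtain ⟨s, hs⟩ := Module.projective_def'.1 ‹Module.Projective A' P›
  exact .of_split (s.restrictScalars A) ((Finsupp.linearCombination A' id).restrictScalars A)
    (LinearMap.ext fun x => LinearMap.congr_fun hs x)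

theorem projective_quotient_map [Module.Projective A A'] (I : Ideal A) :
    Module.Projective (A ⧸ I) (A' ⧸ I.map (algebraMap A A')) :=
  .of_equiv (Algebra.TensorProduct.quotIdealMapEquivQuotTensor A' I).symm.toLinearEquiv

variable (I : Ideal A) (M : Type*) [AddCommGroup M] [Module A M] [Module A' M]
  [IsScalarTower A A' M]

theorem mapOfCompatibleSMul_comp_rTensor_idealMap_surjective :
    Function.Surjective ((TensorProduct.mapOfCompatibleSMul A' A A (I.map (algebraMap A A')) M).comp
      ((Algebra.idealMap A' I).rTensor M)) := by
  rw [← LinearMap.range_eq_top, eq_top_iff]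
  rintro t -
  induction t with
  | zero => exact zero_mem _
  | add s t hs ht => exact add_mem hs ht
  | tmul x m =>
    obtain ⟨x, hx⟩ := x
    induction hx using Submodule.span_induction generalizing m with
    | mem x hx =>
      obtain ⟨i, hi, rfl⟩ := hx
      exact ⟨⟨i, hi⟩ ⊗ₜ m, rfl⟩
    | zero => exact ⟨0, (map_zero _).trans (TensorProduct.zero_tmul _ m).symm⟩
    | add x y hx hy ihx ihy =>
      convert add_mem (ihx m) (ihy m) using 1
      exact TensorProduct.add_tmul (⟨x, hx⟩ : I.map (algebraMap A A')) ⟨y, hy⟩ m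
    | smul a x hx ih =>
      convert ih (a • m) using 1
      exact TensorProduct.smul_tmul (R := A') a (⟨x, hx⟩ : I.map (algebraMap A A')) m

theorem rTensor_map_subtype_injective [Module.Flat A M] :
    Function.Injective ((I.map (algebraMap A A')).subtype.rTensor M) := by
  let φ : I ⊗[A] M →ₗ[A] (I.map (algebraMap A A')) ⊗[A'] M :=
    (TensorProduct.mapOfCompatibleSMul A' A A (I.map (algebraMap A A')) M).comp
      ((Algebra.idealMap A' I).rTensor M)
  have hφ : Function.Surjective φ := mapOfCompatibleSMul_comp_rTensor_idealMap_surjective I M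
  have hcomp : (TensorProduct.lid A' M ∘ (I.map (algebraMap A A')).subtype.rTensor M) ∘ φ =
      TensorProduct.lid A M ∘ I.subtype.rTensor M := by
    ext t
    induction t with
    | zero => simp
    | add s t hs ht => simp_all
    | tmul x m => simp [φ]
  refine .of_comp (f := TensorProduct.lid A' M) (.of_comp_right (g := φ) ?_ hφ)
  rw [hcomp]
  exact (TensorProduct.lid A M).injective.comp
    (Module.Flat.rTensor_preserves_injective_linearMap _ I.subtype_injective)

end ChangeOfRings

section ChangeOfLocalRings

variable {A A' : Type u} [CommRing A] [CommRing A'] [Algebra A A'] [IsLocalRing A] [IsLocalRing A']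
  [IsNoetherianRing A'] (M : Type u) [AddCommGroup M] [Module A M] [Module A' M]
  [IsScalarTower A A' M] [Module.Finite A' M]

theorem free_of_flat_of_map_maximalIdeal_eq [Module.Flat A M]
    (hm : (maximalIdeal A).map (algebraMap A A') = maximalIdeal A') : Module.Free A' M :=
  have := Module.finitePresentation_of_finite A' M
  Module.free_of_maximalIdeal_rTensor_injective (hm ▸ rTensor_map_subtype_injective _ M)

variable [Module.Projective A A']

theorem hasProjectiveDimensionLE_iff_of_map_maximalIdeal_eq
    (hm : (maximalIdeal A).map (algebraMap A A') = maximalIdeal A') (n : ℕ) :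
    HasProjectiveDimensionLE (ModuleCat.of A M) n ↔
      HasProjectiveDimensionLE (ModuleCat.of A' M) n := by
  induction n generalizing M with
  | zero =>
    rw [← projective_iff_hasProjectiveDimensionLE_zero, ← IsProjective.iff_projective,
      ← projective_iff_hasProjectiveDimensionLE_zero, ← IsProjective.iff_projective]
    constructor
    · intro _
      have := free_of_flat_of_map_maximalIdeal_eq M hm
      infer_instance
    · intro _
      exact projective_of_projective_of_isScalarTower (A' := A') M
  | succ n ih =>
    obtain ⟨r, p, hp⟩ := Module.Finite.exists_fin' A' M
    have hF : Projective (ModuleCat.of A (Fin r → A')) :=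
      (IsProjective.iff_projective (Fin r → A')).1
        (projective_of_projective_of_isScalarTower (A' := A') _)
    have hF' : Projective (ModuleCat.of A' (Fin r → A')) :=
      (IsProjective.iff_projective (Fin r → A')).1 inferInstance
    have hS := LinearMap.shortExact_shortComplexKer (f := p.restrictScalars A) hp
    have hS' := LinearMap.shortExact_shortComplexKer hp
    exact (hS.hasProjectiveDimensionLT_X₃_iff n hF).trans <|
      (ih (LinearMap.ker p)).trans (hS'.hasProjectiveDimensionLT_X₃_iff n hF').symm

theorem projectiveDimension_eq_of_map_maximalIdeal_eq
    (hm : (maximalIdeal A).map (algebraMap A A') = maximalIdeal A') :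
    projectiveDimension (ModuleCat.of A M) = projectiveDimension (ModuleCat.of A' M) := by
  refine eq_of_forall_ge_iff fun N => ?_
  induction N with
  | bot => simp only [le_bot_iff, projectiveDimension_eq_bot_iff, ModuleCat.isZero_iff_subsingleton]
  | coe N =>
    induction N with
    | top => simp only [WithBot.coe_top, le_top]
    | coe n =>
      exact (projectiveDimension_le_iff _ n).trans <|
        (hasProjectiveDimensionLE_iff_of_map_maximalIdeal_eq M hm n).trans
          (projectiveDimension_le_iff _ n).symm

end ChangeOfLocalRings

section CohomologicalSupport

variable {Q Q' : Type u} [CommRing Q] [CommRing Q'] [Algebra Q Q'] {I : Ideal Q} {J : Ideal Q'}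
  (hIJ : I ≤ J.comap (algebraMap Q Q'))

theorem nontrivial_targetModule (hJ : J ≠ ⊤) : Nontrivial (targetModule hIJ) :=
  Ideal.Quotient.nontrivial_iff.2 hJ

variable [IsLocalRing Q] [IsLocalRing Q']

theorem VMap_cls_eq_zero_iff (hm : (maximalIdeal Q).map (algebraMap Q Q') = maximalIdeal Q')
    (f : I) : VMap hIJ hm (VSpace.cls f) = 0 ↔ algebraMap Q Q' f ∈ maximalIdeal Q' * J := by
  have hmap : (maximalIdeal Q' • ⊤ : Submodule Q' J).map J.subtype = maximalIdeal Q' * J := by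
    rw [Submodule.map_smul'', Submodule.map_top, Submodule.range_subtype, smul_eq_mul]
  rw [← hmap]
  exact (Submodule.Quotient.mk_eq_zero _).trans
    (Function.Injective.mem_set_image J.subtype_injective).symm

theorem map_maximalIdeal_quotient_span_singleton
    (hm : (maximalIdeal Q).map (algebraMap Q Q') = maximalIdeal Q') {f : Q}
    [IsLocalRing (Q ⧸ Ideal.span {f})]
    [IsLocalRing (Q' ⧸ (Ideal.span {f}).map (algebraMap Q Q'))] :
    (maximalIdeal (Q ⧸ Ideal.span {f})).map
      (algebraMap _ (Q' ⧸ (Ideal.span {f}).map (algebraMap Q Q'))) = maximalIdeal _ := by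
  rw [← map_maximalIdeal_of_surjective _ (Ideal.Quotient.mk_surjective (I := Ideal.span {f})),
    ← map_maximalIdeal_of_surjective _ (Ideal.Quotient.mk_surjective
      (I := (Ideal.span {f}).map (algebraMap Q Q'))), Ideal.map_map, ← hm, Ideal.map_map]
  rfl

theorem pdHypersurface_targetModule_eq_projectiveDimension [IsNoetherianRing Q']
    [Module.Projective Q Q'] (hm : (maximalIdeal Q).map (algebraMap Q Q') = maximalIdeal Q')
    (f : I) (hf : (f : Q) ∈ maximalIdeal Q)
    [Algebra (Q' ⧸ (Ideal.span {(f : Q)}).map (algebraMap Q Q')) (Q' ⧸ J)]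
    [IsScalarTower Q' (Q' ⧸ (Ideal.span {(f : Q)}).map (algebraMap Q Q')) (Q' ⧸ J)] :
    pdHypersurface I f (targetModule hIJ) = projectiveDimension
      (ModuleCat.of (Q' ⧸ (Ideal.span {(f : Q)}).map (algebraMap Q Q')) (Q' ⧸ J)) := by
  let φ : Q ⧸ Ideal.span {(f : Q)} →+* Q' ⧸ J :=
    (Ideal.quotientMap J (algebraMap Q Q') hIJ).comp
      (Ideal.Quotient.factor ((Ideal.span_singleton_le_iff_mem I).2 f.2))
  let _ : Algebra (Q ⧸ Ideal.span {(f : Q)}) (Q' ⧸ J) := φ.toAlgebra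
  have : IsScalarTower (Q ⧸ Ideal.span {(f : Q)})
      (Q' ⧸ (Ideal.span {(f : Q)}).map (algebraMap Q Q')) (Q' ⧸ J) := .of_algebraMap_eq' <|
    Ideal.Quotient.ringHom_ext <| RingHom.ext fun a =>
      IsScalarTower.algebraMap_apply Q' (Q' ⧸ (Ideal.span {(f : Q)}).map (algebraMap Q Q')) (Q' ⧸ J)
        (algebraMap Q Q' a)
  have := isLocalRing_quotient_span_singleton hf
  have hf' : algebraMap Q Q' f ∈ maximalIdeal Q' := hm ▸ Ideal.mem_map_of_mem _ hf
  have : IsLocalRing (Q' ⧸ (Ideal.span {(f : Q)}).map (algebraMap Q Q')) := by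
    rw [Ideal.map_span, Set.image_singleton]
    exact isLocalRing_quotient_span_singleton hf'
  have := projective_quotient_map (A' := Q') (Ideal.span {(f : Q)})
  have : Module.Finite (Q' ⧸ (Ideal.span {(f : Q)}).map (algebraMap Q Q')) (Q' ⧸ J) :=
    .of_restrictScalars_finite Q' _ _
  have hpd : pdHypersurface I f (targetModule hIJ) =
      projectiveDimension (ModuleCat.of (Q ⧸ Ideal.span {(f : Q)}) (Q' ⧸ J)) := rfl
  rw [hpd]
  exact projectiveDimension_eq_of_map_maximalIdeal_eq (Q' ⧸ J)
    (map_maximalIdeal_quotient_span_singleton hm)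

variable [IsNoetherianRing Q'] [Module.Projective Q Q']

theorem pdHypersurface_targetModule_eq_top_iff
    (hm : (maximalIdeal Q).map (algebraMap Q Q') = maximalIdeal Q') {g : List Q'}
    (hg : IsRegular Q' g) (hJ : J = Ideal.ofList g) (f : I)
    (hf : algebraMap Q Q' f ∈ nonZeroDivisors Q') :
    pdHypersurface I f (targetModule hIJ) = ⊤ ↔ algebraMap Q Q' f ∈ maximalIdeal Q' * J := by
  subst hJ
  have hfm : (f : Q) ∈ maximalIdeal Q := fun hu =>
    ofList_ne_top_of_isRegular hg <|
      Ideal.eq_top_of_isUnit_mem _ (hIJ f.2) (hu.map (algebraMap Q Q'))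
  have hspan : (Ideal.span {(f : Q)}).map (algebraMap Q Q') = Ideal.span {algebraMap Q Q' f} := by
    rw [Ideal.map_span, Set.image_singleton]
  have hle : (Ideal.span {(f : Q)}).map (algebraMap Q Q') ≤ Ideal.ofList g :=
    hspan ▸ (Ideal.span_singleton_le_iff_mem _).2 (hIJ f.2)
  let _ : Algebra (Q' ⧸ (Ideal.span {(f : Q)}).map (algebraMap Q Q')) (Q' ⧸ Ideal.ofList g) :=
    (Ideal.Quotient.factor hle).toAlgebra
  have : IsScalarTower Q' (Q' ⧸ (Ideal.span {(f : Q)}).map (algebraMap Q Q'))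
      (Q' ⧸ Ideal.ofList g) := .of_algebraMap_eq fun _ => rfl
  rw [pdHypersurface_targetModule_eq_projectiveDimension hIJ hm f hfm]
  exact projectiveDimension_eq_top_iff_mem_maximalIdeal_mul_ofList Ideal.Quotient.mk_surjective
    (Ideal.mk_ker.trans hspan) hf Ideal.Quotient.mk_surjective Ideal.mk_ker hg

end CohomologicalSupport

theorem lemma2p6_general {Q Q' : Type u} [CommRing Q] [CommRing Q'] [IsLocalRing Q]
    [IsLocalRing Q'] [IsNoetherianRing Q'] [IsDomain Q'] [Algebra Q Q'] [Module.Free Q Q']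
    (hm : (maximalIdeal Q).map (algebraMap Q Q') = maximalIdeal Q')
    (I : Ideal Q) (J : Ideal Q') (hIJ : I ≤ J.comap (algebraMap Q Q'))
    (hJ : ∃ g : List Q', IsRegular Q' g ∧ J = Ideal.ofList g) :
    cohomologicalSupport I (targetModule hIJ) = (LinearMap.ker (VMap hIJ hm) : Set (VSpace I)) ∧
    ∀ f : I, (f : Q) ≠ 0 →
      (pdHypersurface I f (targetModule hIJ) = ⊤ ↔ algebraMap Q Q' f ∈ maximalIdeal Q' * J) := by
  obtain ⟨g, hg, hJg⟩ := hJ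
  have hpd (f : I) (hf : (f : Q) ≠ 0) : pdHypersurface I f (targetModule hIJ) = ⊤ ↔
      algebraMap Q Q' f ∈ maximalIdeal Q' * J :=
    pdHypersurface_targetModule_eq_top_iff hIJ hm hg hJg f <| mem_nonZeroDivisors_of_ne_zero <|
      (map_ne_zero_iff _ (FaithfulSMul.algebraMap_injective Q Q')).2 hf
  have hS := nontrivial_targetModule hIJ (hJg ▸ ofList_ne_top_of_isRegular hg)
  refine ⟨Set.ext fun v => ⟨?_, fun hv => ⟨hS, ?_⟩⟩, hpd⟩
  · rintro ⟨-, ⟨f, rfl, htop⟩ | rfl⟩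
    · rw [SetLike.mem_coe, LinearMap.mem_ker, VMap_cls_eq_zero_iff]
      by_cases hf : (f : Q) = 0
      · rw [hf, map_zero]
        exact zero_mem _
      · exact (hpd f hf).1 htop
    · exact zero_mem _
  · obtain ⟨f, rfl⟩ : ∃ f : I, VSpace.cls f = v := Submodule.Quotient.mk_surjective _ v
    obtain rfl | hf := eq_or_ne f 0
    · exact .inr rfl
    · exact .inl ⟨f, rfl, (hpd f (Subtype.coe_ne_coe.2 hf)).2
        ((VMap_cls_eq_zero_iff hIJ hm f).1 hv)⟩

theorem lemma2p6 {Q Q' : Type u} [CommRing Q] [CommRing Q']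
    [IsRegularLocalRing Q] [IsRegularLocalRing Q']
    [Algebra Q Q'] [Module.Finite Q Q'] [Module.Flat Q Q']
    (hm : (IsLocalRing.maximalIdeal Q).map (algebraMap Q Q') = IsLocalRing.maximalIdeal Q')
    (I : Ideal Q) (J : Ideal Q') (hIJ : I ≤ J.comap (algebraMap Q Q'))
    (hJ : ∃ g : List Q', RingTheory.Sequence.IsRegular Q' g ∧ J = Ideal.ofList g) :
    cohomologicalSupport I (targetModule hIJ) = (LinearMap.ker (VMap hIJ hm) : Set (VSpace I)) ∧
    ∀ f : I, (f : Q) ≠ 0 →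
      (pdHypersurface I f (targetModule hIJ) = ⊤ ↔
        algebraMap Q Q' f ∈ IsLocalRing.maximalIdeal Q' * J) := by
  have : IsDomain Q' := isDomain_of_isRegularLocalRing Q'
  have : Module.Free Q Q' := Module.free_of_flat_of_isLocalRing
  exact lemma2p6_general hm I J hIJ hJ
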